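/- Let $N,\tau\ge 1$ and $M\ge 0$ be integers and let $p_{ij}\in[0,1]$ for $1\le i\le N$, $1\le j\le M$. $N$ access points serve $M$ clients in discrete time-slots, which are grouped into consecutive intervals of $\tau$ slots. In every slot the channel from access point $i$ to client $j$ is successful with probability $p_{ij}$, independently over slots and over pairs $(i,j)$. At the beginning of each interval every client requests one new packet, and each of these $M$ packets is assigned to exactly one access point. In each slot every access point transmits at most one packet, chosen among the packets assigned to it in the current interval that are not yet delivered, and at the end of the slot it learns whether the transmission succeeded, i.e. whether the channel used was successful in that slot; packets not delivered by the end of the interval are dropped. A scheduling policy $\eta$ makes all these decisions (assignments and transmissions) causally, as a function of the entire past history of events (assignments, transmissions and their outcomes) and, possibly, of a private random seed that is independent of the channels and has a fixed law (a constant seed gives the deterministic policies). Let $N_j(k,\eta)\in\{0,1\}$ indicate whether client $j$ receives its packet in the $k$-th interval. The total timely throughput $\mathsf T^3(\eta)$ is the largest $R$ such that, with probability one, $$\limsup_{r\to\infty}\frac1r\sum_{k=1}^r\sum_{j=1}^M N_j(k,\eta)\ \ge\ R ,$$ and $C_{\mathsf T^3}=\sup_\eta \mathsf T^3(\eta)$,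 the supremum over all scheduling policies. Let $$C_{\det}=\max\Big\{\sum_{i=1}^N\sum_{j=1}^M x_{ij}\ :\ x_{ij}\in\{0,1\},\ \ \sum_{j=1}^M \frac{x_{ij}}{p_{ij}}\le\tau\ \ (1\le i\le N),\ \ \sum_{i=1}^N x_{ij}\le 1\ \ (1\le j\le M)\Big\},$$ where $x_{ij}/p_{ij}$ for $p_{ij}=0$ means $0$ if $x_{ij}=0$ and $+\infty$ if $x_{ij}=1$. Then, for every law of the seed, $$C_{\det}-2\sqrt{N\Big(C_{\det}+\frac N4\Big)}\;<\;C_{\mathsf T^3}\;<\;C_{\det}+N .$$ -/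

import Mathlib

open MeasureTheory ProbabilityTheory Filter

/-- An assignment of the packets requested for one interval (one packet per client) to the
access points: `a j` is the access point that is responsible for the packet of client `j`. -/
abbrev Assignment (N M : ℕ) := Fin M → Fin N

/-- The observable events. At the start of an interval the packets are assigned to the access
points; in a time-slot each access point either is idle (`none`) or transmits the packet of a
client `j` and learns whether the packet was delivered (`some (j, b)`). -/
inductive Event (N M : ℕ) where
  | assigned (a : Assignment N M) : Event N M
  | slot (e : Fin N → Option (Fin M × Bool)) : Event N M

/-- The past history of events, the most recent one first. -/
abbrev History (N M : ℕ) := List (Event N M)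

/-- A causal scheduling policy. Its decisions are functions of the entire past history of events
and of a private random seed `s : S`; for a one-point space `S` these are the
deterministic policies. `transmit s h i` is the packet that access point `i` picks
for the next time-slot (`none`: idle). -/
structure Policy (N M : ℕ) (S : Type*) [MeasurableSpace S] where
  assign : S → History N M → Assignment N M
  transmit : S → History N M → Fin N → Option (Fin M)
  measurable_assign : ∀ h a, MeasurableSet {s | assign s h = a}
  measurable_transmit : ∀ h f, MeasurableSet {s | transmit s h = f}

/-- The state of the system inside an interval: the history of all events so far, the assignment
in force, and the clients whose packet of the current interval has been delivered. -/
structure SysState (N M : ℕ) where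
  history : History N M
  assignment : Assignment N M
  delivered : Finset (Fin M)

section Dynamics

variable {N M : ℕ} {S : Type*} [MeasurableSpace S]

/-- The start of an interval: the newly requested packets are assigned, none is delivered. -/
def startInterval (η : Policy N M S) (s : S) (h : History N M) : SysState N M where
  history := Event.assigned (η.assign s h) :: h
  assignment := η.assign s h
  delivered := ∅

/-- The packet that access point `i` transmits in the next time-slot. It has to be in the buffer
of `i`, i.e. assigned to `i` and not yet delivered; otherwise `i` stays idle. -/
def transmission (η : Policy N M S) (s : S) (st : SysState N M) (i : Fin N) : Option (Fin M) :=
  (η.transmit s st.history i).filter fun j => decide (st.assignment j = i ∧ j ∉ st.delivered)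

/-- One time-slot; `c i j` tells whether the channel from access point `i` to client `j` is
successful (`true`) or erases the packet (`false`) in this time-slot. -/
def slotStep (η : Policy N M S) (s : S) (c : Fin N → Fin M → Bool) (st : SysState N M) :
    SysState N M where
  history := Event.slot (fun i => (transmission η s st i).map fun j => (j, c i j)) :: st.history
  assignment := st.assignment
  delivered := st.delivered ∪
    Finset.univ.filter fun j => ∃ i, transmission η s st i = some j ∧ c i j = true

/-- The state after the first `t` time-slots of an interval that is entered with history `h`;
`c u` are the channel states in the time-slot number `u` of this interval. -/
def runInterval (η : Policy N M S) (s : S) (c : ℕ → Fin N → Fin M → Bool) (h : History N M) :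
    ℕ → SysState N M
  | 0 => startInterval η s h
  | t + 1 => slotStep η s (c t) (runInterval η s c h t)

/-- Realizations of all channels: `ω (n, i, j)` is the state in time-slot `n` of the channel from
access point `i` to client `j`. -/
abbrev ChannelSpace (N M : ℕ) := ℕ × Fin N × Fin M → Bool

/-- The channel states in the interval number `k` (counted from `0`), i.e. in the time-slots
`k * τ, …, k * τ + τ - 1`. -/
def intervalChannels (τ : ℕ) (ω : ChannelSpace N M) (k : ℕ) : ℕ → Fin N → Fin M → Bool :=
  fun t i j => ω (k * τ + t, i, j)

/-- The history before the interval number `k`. -/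
def historyBefore (τ : ℕ) (η : Policy N M S) (s : S) (ω : ChannelSpace N M) : ℕ → History N M
  | 0 => []
  | k + 1 => (runInterval η s (intervalChannels τ ω k) (historyBefore τ η s ω k) τ).history

/-- The clients that successfully receive a packet during the interval number `k`. -/
def deliveredIn (τ : ℕ) (η : Policy N M S) (s : S) (ω : ChannelSpace N M) (k : ℕ) :
    Finset (Fin M) :=
  (runInterval η s (intervalChannels τ ω k) (historyBefore τ η s ω k) τ).delivered

/-- `N_j(k, η)`: it is `1` if client `j` receives a packet during the interval number `k`,
and `0` otherwise. -/
def deliveryIndicator (τ : ℕ) (η : Policy N M S) (s : S) (ω : ChannelSpace N M) (k : ℕ)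
    (j : Fin M) : ℝ :=
  if j ∈ deliveredIn τ η s ω k then 1 else 0

end Dynamics

noncomputable section Throughput

variable {N M : ℕ} {S : Type*} [MeasurableSpace S]

/-- The law of the erasure channels: independent over time-slots and over pairs `(i, j)`, the
channel `(i, j)` being successful with probability `p i j` in each time-slot. -/
def channelMeasure (p : Fin N → Fin M → unitInterval) : Measure (ChannelSpace N M) :=
  Measure.infinitePi fun e : ℕ × Fin N × Fin M => bernoulliMeasure true false (p e.2.1 e.2.2)

/-- The long-term average number of deliveries per interval along a sample path. -/
def pathThroughput (τ : ℕ) (η : Policy N M S) (s : S) (ω : ChannelSpace N M) : ℝ :=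
  limsup (fun r : ℕ =>
    (∑ k ∈ Finset.range r, ∑ j : Fin M, deliveryIndicator τ η s ω k j) / (r : ℝ)) atTop

/-- The total timely throughput of a policy whose seed has law `ν`: the largest `R` such that the
long-term average number of deliveries is at least `R` with probability one. -/
def totalTimelyThroughput (τ : ℕ) (p : Fin N → Fin M → unitInterval) (ν : Measure S)
    (η : Policy N M S) : ℝ :=
  sSup {R : ℝ | ∀ᵐ z ∂(ν.prod (channelMeasure p)), R ≤ pathThroughput τ η z.1 z.2}

/-- The maximum total timely throughput over all causal scheduling policies. -/
def maxThroughput (τ : ℕ) (p : Fin N → Fin M → unitInterval) (ν : Measure S) : ℝ :=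
  ⨆ η : Policy N M S, totalTimelyThroughput τ p ν η

end Throughput

section Relaxation

variable {N M : ℕ}

/-- Feasibility for the relaxed problem: a 0-1 packing of items (clients) into bins
(access points) of capacity `τ`, where item `j` has size `1 / p i j` in bin `i`. Sizes are
extended real numbers: the size is `∞` if `p i j = 0`, and `0 / 0 = 0` (an item that is
not packed takes no room). -/
structure IsPacking (τ : ℕ) (p : Fin N → Fin M → unitInterval) (x : Fin N → Fin M → ℕ) : Prop where
  zero_or_one : ∀ i j, x i j = 0 ∨ x i j = 1
  capacity : ∀ i, ∑ j, (x i j : ENNReal) / ENNReal.ofReal (p i j : ℝ) ≤ (τ : ENNReal)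
  at_most_once : ∀ j, ∑ i, x i j ≤ 1

/-- The optimum of the relaxed problem (the set is nonempty, and bounded by `M`). -/
noncomputable def packingOptimum (τ : ℕ) (p : Fin N → Fin M → unitInterval) : ℕ :=
  sSup {n : ℕ | ∃ x : Fin N → Fin M → ℕ, IsPacking τ p x ∧ n = ∑ i, ∑ j, x i j}

end Relaxation

/-!
The channels are memoryless, so the state of the system is a controlled Markov chain. The tool for
this is `splice`: replacing everything after a given time-slot by an independent copy of the channel
process preserves its law (`measurePreserving_splice`), which gives the conditional expectations
over a single slot (`integral_freshInterval_succ`) and over a single interval. If the expected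
number of deliveries in an interval is bounded, uniformly over the history with which the interval
is entered, then almost surely the long-term average obeys the same bound; this is a one-sided
strong law proved with exponential moments (`ae_eventually_sum_le`). It remains to bound
the expectation over one interval.

Upper bound. By Wald's identity (`deliveryProb_eq`), client `j` is served with probability
`p i j * u j`, where `i` is its access point and `u j` the expected number of transmissions to `j`.
An access point makes at most `τ` transmissions, so the delivery probabilities of its clients solve
the linear relaxation of a knapsack problem with weights `1 / p i j`. The value of the relaxation
exceeds the 0-1 optimum by less than `1` (`exists_fractional_knapsack_bound`), and summing over the
`N` access points gives a bound smaller than the packing optimum plus `N`. It is uniform over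
the policies, since there are only finitely many assignments.

Lower bound. Fix an optimal packing `J i` and let every access point transmit to its unserved
client with the largest success probability. For access point `i` let `U` be the set of unserved
clients of `J i`, and `q` their largest success probability. The potential
`((t - ∑ j ∈ J i \ U, 1 / p i j) * q) ^ 2 + |U|` is a supermartingale (`servicePotential_step`). It
starts at `|J i|`, and at the end of the interval it is at least `|U| ^ 2`, since `J i` fits into
`τ` slots on average. Hence the second moment of `|U|` is at most `|J i|`, and by the Cauchy–Schwarz
inequality the expected total loss is at most the square root of `N` times the packing optimum.
-/

/-! ### Memoryless channels -/

section Splice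

variable {N M : ℕ}

/-- The channel realization that follows `ω` in the first `n` time-slots and then starts `ω'`
from its time-slot `0`. -/
def splice (n : ℕ) (ω ω' : ChannelSpace N M) : ChannelSpace N M :=
  fun e => if e.1 < n then ω e else ω' (e.1 - n, e.2)

lemma splice_of_lt {n : ℕ} (ω ω' : ChannelSpace N M) {e : ℕ × Fin N × Fin M} (h : e.1 < n) :
    splice n ω ω' e = ω e := if_pos h

lemma splice_add (n t : ℕ) (ω ω' : ChannelSpace N M) (e : Fin N × Fin M) :
    splice n ω ω' (n + t, e) = ω' (t, e) := by simp [splice]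

instance isProbabilityMeasure_channelMeasure (p : Fin N → Fin M → unitInterval) :
    IsProbabilityMeasure (channelMeasure p) := by
  unfold channelMeasure; infer_instance

lemma measurable_splice (n : ℕ) :
    Measurable fun z : ChannelSpace N M × ChannelSpace N M => splice n z.1 z.2 := by
  refine measurable_pi_lambda _ fun e => ?_
  by_cases h : e.1 < n
  · simp only [splice, h, if_true]; fun_prop
  · simp only [splice, h, if_false]; fun_prop

/-- The channels are memoryless: replacing everything after time-slot `n` by an independent copy
of the whole process does not change the law. -/
lemma measurePreserving_splice (p : Fin N → Fin M → unitInterval) (n : ℕ) :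
    MeasurePreserving (fun z : ChannelSpace N M × ChannelSpace N M => splice n z.1 z.2)
      ((channelMeasure p).prod (channelMeasure p)) (channelMeasure p) := by
  classical
  refine ⟨measurable_splice n, ?_⟩
  refine Measure.eq_infinitePi _ fun s t ht => ?_
  rw [Measure.map_apply (measurable_splice n) (MeasurableSet.pi s.countable_toSet fun i _ => ht i)]
  set s₁ := s.filter fun e => e.1 < n
  set s₂ := s.filter fun e => ¬ e.1 < n
  set g : ℕ × Fin N × Fin M → ℕ × Fin N × Fin M := fun e => (e.1 - n, e.2)
  have hinj : Set.InjOn g s₂ := by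
    intro e he e' he' h
    simp only [s₂, Finset.coe_filter, Set.mem_ofPred_eq, not_lt] at he he'
    simp only [g, Prod.mk.injEq] at h
    refine Prod.ext ?_ h.2
    have := h.1
    omega
  have hpre : (fun z : ChannelSpace N M × ChannelSpace N M => splice n z.1 z.2) ⁻¹' Set.pi s t
      = Set.pi s₁ t ×ˢ Set.pi (s₂.image g) (fun e => t (e.1 + n, e.2)) := by
    ext z
    simp only [Set.mem_preimage, Set.mem_pi, Set.mem_prod, Finset.mem_coe, Finset.mem_image,
      forall_exists_index, and_imp]
    constructor
    · intro h
      refine ⟨fun e he => ?_, ?_⟩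
      · have he' := Finset.mem_filter.1 he
        simpa [splice, he'.2] using h e he'.1
      · rintro _ e he rfl
        have he' := Finset.mem_filter.1 he
        have hn : e.1 - n + n = e.1 := by omega
        simpa [splice, he'.2, g, hn] using h e he'.1
    · rintro ⟨h₁, h₂⟩ e he
      by_cases hn : e.1 < n
      · simpa [splice, hn] using h₁ e (Finset.mem_filter.2 ⟨he, hn⟩)
      · have hn' : e.1 - n + n = e.1 := by omega
        simpa [splice, hn, g, hn'] using h₂ _ e (Finset.mem_filter.2 ⟨he, hn⟩) rfl
  rw [hpre, Measure.prod_prod, channelMeasure, Measure.infinitePi_pi _ (fun i _ => ht i),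
    Measure.infinitePi_pi _ (fun i _ => ht _), Finset.prod_image hinj,
    ← Finset.prod_filter_mul_prod_filter_not s (fun e => e.1 < n)]
  congr 1
  refine Finset.prod_congr rfl fun e he => ?_
  have he' := Finset.mem_filter.1 he
  have hn' : e.1 - n + n = e.1 := by omega
  simp [g, hn']

lemma DependsOn.exists_eq_comp {X : Type*} {n : ℕ} {f : ChannelSpace N M → X}
    (hf : DependsOn f {e | e.1 < n}) :
    ∃ g : (Fin n × Fin N × Fin M → Bool) → X, f = fun ω => g fun e => ω (e.1, e.2) := by
  refine ⟨fun v => f fun e => if h : e.1 < n then v (⟨e.1, h⟩, e.2) else false, ?_⟩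
  funext ω
  refine hf fun e he => ?_
  have he : e.1 < n := he
  simp [he]

lemma DependsOn.measurable_of_slots {X : Type*} [MeasurableSpace X] {n : ℕ}
    {f : ChannelSpace N M → X} (hf : DependsOn f {e | e.1 < n}) : Measurable f := by
  obtain ⟨g, rfl⟩ := hf.exists_eq_comp
  have hg : Measurable g := Measurable.of_discrete
  exact hg.comp (by fun_prop)

/-- A function of finitely many time-slots has finitely many values, so it is bounded. -/
lemma DependsOn.exists_bound {n : ℕ} {f : ChannelSpace N M → ℝ} (hf : DependsOn f {e | e.1 < n}) :
    ∃ B, ∀ ω, ‖f ω‖ ≤ B := by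
  obtain ⟨g, rfl⟩ := hf.exists_eq_comp
  obtain ⟨B, hB⟩ := (Set.finite_range fun v => ‖g v‖).bddAbove
  exact ⟨B, fun ω => hB ⟨_, rfl⟩⟩

lemma DependsOn.integrable_of_slots (p : Fin N → Fin M → unitInterval) {n : ℕ}
    {f : ChannelSpace N M → ℝ} (hf : DependsOn f {e | e.1 < n}) :
    Integrable f (channelMeasure p) := by
  obtain ⟨B, hB⟩ := hf.exists_bound
  exact Integrable.of_bound hf.measurable_of_slots.aestronglyMeasurable B (ae_of_all _ hB)

/-- Conditioning on the first `n` time-slots. -/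
lemma integral_splice (p : Fin N → Fin M → unitInterval) {m : ℕ} {f : ChannelSpace N M → ℝ}
    (hf : DependsOn f {e | e.1 < m}) (n : ℕ) :
    ∫ ω, f ω ∂channelMeasure p
      = ∫ ω, ∫ ω', f (splice n ω ω') ∂channelMeasure p ∂channelMeasure p := by
  have hi := hf.integrable_of_slots p
  have hs := measurePreserving_splice p n
  rw [← integral_prod (fun z : ChannelSpace N M × ChannelSpace N M => f (splice n z.1 z.2))
    (hs.integrable_comp_of_integrable hi)]
  conv_lhs => rw [← hs.map_eq]
  exact integral_map hs.measurable.aemeasurable hf.measurable_of_slots.aestronglyMeasurable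

lemma integral_channel (p : Fin N → Fin M → unitInterval) (e : ℕ × Fin N × Fin M) (φ : Bool → ℝ) :
    ∫ ω, φ (ω e) ∂channelMeasure p
      = (p e.2.1 e.2.2 : ℝ) * φ true + (1 - (p e.2.1 e.2.2 : ℝ)) * φ false := by
  have h := measurePreserving_eval_infinitePi
    (fun e : ℕ × Fin N × Fin M => bernoulliMeasure true false (p e.2.1 e.2.2)) e
  have h2 := integral_map (μ := channelMeasure p) h.measurable.aemeasurable (f := φ)
    (Measurable.of_discrete).aestronglyMeasurable
  rw [channelMeasure, h.map_eq] at h2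
  rw [channelMeasure]
  refine h2.symm.trans ?_
  rw [integral_bernoulliMeasure]
  simp [smul_eq_mul]

end Splice

/-! ### The Markov property of the dynamics -/

section FreshInterval

variable {N M : ℕ} {S : Type*} [MeasurableSpace S]

/-- The state after `t` slots of an interval that is entered with history `h` and
whose channels are those of `ω`, read from time-slot `0` on. -/
def freshInterval (η : Policy N M S) (s : S) (h : History N M) (t : ℕ) (ω : ChannelSpace N M) :
    SysState N M :=
  runInterval η s (fun u i j => ω (u, i, j)) h t

lemma runInterval_congr (η : Policy N M S) (s : S) {c c' : ℕ → Fin N → Fin M → Bool}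
    (h : History N M) {t : ℕ} (hc : ∀ u < t, c u = c' u) :
    runInterval η s c h t = runInterval η s c' h t := by
  induction t with
  | zero => rfl
  | succ t ih =>
    rw [runInterval, runInterval, ih fun u hu => hc u (by omega), hc t (by omega)]

lemma dependsOn_freshInterval (η : Policy N M S) (s : S) (h : History N M) (t : ℕ) :
    DependsOn (freshInterval η s h t) {e | e.1 < t} := by
  intro ω ω' hω
  refine runInterval_congr η s h fun u hu => ?_
  funext i j
  exact hω _ hu

lemma freshInterval_assignment (η : Policy N M S) (s : S) (h : History N M) (t : ℕ)
    (ω : ChannelSpace N M) : (freshInterval η s h t ω).assignment = η.assign s h := by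
  induction t with
  | zero => rfl
  | succ t ih => exact ih

lemma freshInterval_succ_splice (η : Policy N M S) (s : S) (h : History N M) (t : ℕ)
    (ω ω' : ChannelSpace N M) :
    freshInterval η s h (t + 1) (splice t ω ω')
      = slotStep η s (fun i j => ω' (0, i, j)) (freshInterval η s h t ω) := by
  rw [freshInterval, runInterval]
  congr 1
  · funext i j
    exact splice_add t 0 ω ω' (i, j)
  · exact dependsOn_freshInterval η s h t fun e he => splice_of_lt ω ω' he

/-- The one-step (Markov) property inside an interval. -/
lemma integral_freshInterval_succ (p : Fin N → Fin M → unitInterval) (η : Policy N M S) (s : S)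
    (h : History N M) (t : ℕ) (F : SysState N M → ℝ) :
    ∫ ω, F (freshInterval η s h (t + 1) ω) ∂channelMeasure p
      = ∫ ω, ∫ ω', F (slotStep η s (fun i j => ω' (0, i, j)) (freshInterval η s h t ω))
          ∂channelMeasure p ∂channelMeasure p := by
  have hd : DependsOn (fun ω => F (freshInterval η s h (t + 1) ω)) {e | e.1 < t + 1} :=
    fun ω ω' hω => congrArg F (dependsOn_freshInterval η s h (t + 1) hω)
  rw [integral_splice p hd t]
  simp_rw [freshInterval_succ_splice]

lemma integrable_freshInterval (p : Fin N → Fin M → unitInterval) (η : Policy N M S) (s : S)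
    (h : History N M) (t : ℕ) (F : SysState N M → ℝ) :
    Integrable (fun ω => F (freshInterval η s h t ω)) (channelMeasure p) := by
  have hd : DependsOn (fun ω => F (freshInterval η s h t ω)) {e | e.1 < t} :=
    fun ω ω' hω => congrArg F (dependsOn_freshInterval η s h t hω)
  exact hd.integrable_of_slots p

lemma dependsOn_historyBefore (τ : ℕ) (η : Policy N M S) (s : S) (k : ℕ) :
    DependsOn (fun ω => historyBefore τ η s ω k) {e | e.1 < k * τ} := by
  induction k with
  | zero => intro ω ω' _; rfl
  | succ k ih =>
    intro ω ω' hω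
    have h1 : historyBefore τ η s ω k = historyBefore τ η s ω' k :=
      ih fun e (he : e.1 < k * τ) => hω e (show e.1 < (k + 1) * τ by rw [add_mul]; omega)
    simp only [historyBefore, h1]
    congr 1
    refine runInterval_congr η s _ fun u hu => ?_
    funext i j
    exact hω (k * τ + u, i, j) (show k * τ + u < (k + 1) * τ by rw [add_mul]; omega)

lemma dependsOn_deliveredIn (τ : ℕ) (η : Policy N M S) (s : S) (k : ℕ) :
    DependsOn (fun ω => deliveredIn τ η s ω k) {e | e.1 < (k + 1) * τ} := by
  intro ω ω' hω
  have h1 : historyBefore τ η s ω k = historyBefore τ η s ω' k :=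
    dependsOn_historyBefore τ η s k fun e (he : e.1 < k * τ) =>
      hω e (show e.1 < (k + 1) * τ by rw [add_mul]; omega)
  simp only [deliveredIn, h1]
  congr 1
  refine runInterval_congr η s _ fun u hu => ?_
  funext i j
  exact hω (k * τ + u, i, j) (show k * τ + u < (k + 1) * τ by rw [add_mul]; omega)

lemma deliveredIn_splice (τ : ℕ) (η : Policy N M S) (s : S) (k : ℕ) (ω ω' : ChannelSpace N M) :
    deliveredIn τ η s (splice (k * τ) ω ω') k
      = (freshInterval η s (historyBefore τ η s ω k) τ ω').delivered := by
  have h1 : historyBefore τ η s (splice (k * τ) ω ω') k = historyBefore τ η s ω k :=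
    dependsOn_historyBefore τ η s k fun e he => splice_of_lt ω ω' he
  have h2 : intervalChannels τ (splice (k * τ) ω ω') k = fun u i j => ω' (u, i, j) := by
    funext u i j
    exact splice_add _ _ _ _ _
  rw [deliveredIn, h1, h2, freshInterval]

lemma deliveredIn_splice_of_lt (τ : ℕ) (η : Policy N M S) (s : S) {k r : ℕ} (hk : k < r)
    (ω ω' : ChannelSpace N M) :
    deliveredIn τ η s (splice (r * τ) ω ω') k = deliveredIn τ η s ω k :=
  dependsOn_deliveredIn τ η s k fun e (he : e.1 < (k + 1) * τ) =>
    splice_of_lt ω ω' (he.trans_le (Nat.mul_le_mul_right τ hk))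

end FreshInterval

/-! ### A one-sided strong law -/

section StrongLaw

variable {N M : ℕ} {S : Type*} [MeasurableSpace S]

/-- A bounded variable with mean at most `b` has an exponential moment below `1` once it is
shifted by more than `b`. -/
lemma integral_exp_le {Ω : Type*} [MeasurableSpace Ω] {P : Measure Ω} [IsProbabilityMeasure P]
    {f : Ω → ℝ} (hf : Measurable f) {b ε B : ℝ} (hε : 0 < ε) (hεB : ε ≤ B)
    (hB : ∀ ω, |f ω - (b + ε)| ≤ B) (hb : ∫ ω, f ω ∂P ≤ b) :
    ∫ ω, Real.exp (ε / (2 * B ^ 2) * (f ω - (b + ε))) ∂P ≤ 1 - ε ^ 2 / (4 * B ^ 2) := by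
  have hB0 : 0 < B := hε.trans_le hεB
  set l := ε / (2 * B ^ 2) with hl
  have hl0 : 0 < l := by positivity
  have hlB : l * B ≤ 1 := by
    rw [hl, div_mul_eq_mul_div, div_le_one (by positivity)]
    nlinarith
  have hfi : Integrable f P := by
    refine Integrable.of_bound hf.aestronglyMeasurable (B + |b + ε|) (ae_of_all _ fun ω => ?_)
    have h1 : |f ω| ≤ |f ω - (b + ε)| + |b + ε| := by
      simpa using abs_add_le (f ω - (b + ε)) (b + ε)
    rw [Real.norm_eq_abs]
    linarith [hB ω]
  have hg : Integrable (fun ω => 1 + l * (f ω - (b + ε)) + (l * B) ^ 2) P := by fun_prop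
  have habs : ∀ ω, |l * (f ω - (b + ε))| ≤ l * B := fun ω => by
    rw [abs_mul, abs_of_pos hl0]
    exact mul_le_mul_of_nonneg_left (hB ω) hl0.le
  have hpt : ∀ ω, Real.exp (l * (f ω - (b + ε))) ≤ 1 + l * (f ω - (b + ε)) + (l * B) ^ 2 := by
    intro ω
    have h1 := (abs_le.1 (Real.abs_exp_sub_one_sub_id_le ((habs ω).trans hlB))).2
    have h2 : (l * (f ω - (b + ε))) ^ 2 ≤ (l * B) ^ 2 := sq_le_sq' (by
      linarith [(abs_le.1 (habs ω)).1]) (abs_le.1 (habs ω)).2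
    linarith
  have hexp : Integrable (fun ω => Real.exp (l * (f ω - (b + ε)))) P := by
    refine Integrable.mono' hg (by fun_prop) (ae_of_all _ fun ω => ?_)
    rw [Real.norm_eq_abs, Real.abs_exp]
    exact hpt ω
  refine (integral_mono hexp hg hpt).trans ?_
  have hint : ∫ ω, (1 + l * (f ω - (b + ε)) + (l * B) ^ 2) ∂P
      = 1 + l * (∫ ω, f ω ∂P - (b + ε)) + (l * B) ^ 2 := by
    rw [integral_add (by fun_prop) (by fun_prop), integral_add (by fun_prop) (by fun_prop),
      integral_const_mul, integral_sub hfi (by fun_prop)]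
    simp
  rw [hint]
  have h3 : l * (∫ ω, f ω ∂P - (b + ε)) ≤ l * (-ε) :=
    mul_le_mul_of_nonneg_left (by linarith) hl0.le
  have h4 : 1 + l * (-ε) + (l * B) ^ 2 = 1 - ε ^ 2 / (4 * B ^ 2) := by
    rw [hl]; field_simp; ring
  linarith

/-- The one-sided strong law for the deliveries. If the expected value of `c` times the number of
deliveries in an interval is at most `b`, whatever the past, then so is the long-term average, up to
`ε`; the signs `c = 1` and `c = -1` give upper and lower bounds. The exponential moments of the
partial sums decay geometrically, hence are almost surely summable. -/
lemma ae_eventually_sum_le (p : Fin N → Fin M → unitInterval) (τ : ℕ) (η : Policy N M S) (s : S)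
    {c b : ℝ} (hc : |c| ≤ 1)
    (hb : ∀ h, ∫ ω, c * ((freshInterval η s h τ ω).delivered.card : ℝ) ∂channelMeasure p ≤ b)
    {ε : ℝ} (hε : 0 < ε) :
    ∀ᵐ ω ∂channelMeasure p, ∀ᶠ r : ℕ in atTop,
      ∑ k ∈ Finset.range r, c * ((deliveredIn τ η s ω k).card : ℝ) ≤ r * (b + ε) := by
  set B : ℝ := M + |b| + ε with hB
  have hεB : ε ≤ B := by
    rw [hB]
    linarith [abs_nonneg b, Nat.cast_nonneg (α := ℝ) M]
  have hB0 : 0 < B := hε.trans_le hεB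
  set l := ε / (2 * B ^ 2) with hl
  have hl0 : 0 < l := by positivity
  set q := 1 - ε ^ 2 / (4 * B ^ 2) with hq
  have hq1 : q < 1 := by
    have : 0 < ε ^ 2 / (4 * B ^ 2) := by positivity
    linarith
  have hq0 : 0 ≤ q := by
    rw [hq, sub_nonneg, div_le_one (by positivity)]
    nlinarith
  have hstep : ∀ h, ∫ ω, Real.exp (l * (c * ((freshInterval η s h τ ω).delivered.card : ℝ)
      - (b + ε))) ∂channelMeasure p ≤ q := by
    intro h
    refine integral_exp_le (P := channelMeasure p) ?_ hε hεB (fun ω => ?_) (hb h)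
    · exact DependsOn.measurable_of_slots (n := τ) fun ω ω' hω => by
        rw [dependsOn_freshInterval η s h τ hω]
    · have h1 : ((freshInterval η s h τ ω).delivered.card : ℝ) ≤ M := by
        exact_mod_cast (Finset.card_le_univ _).trans_eq (Fintype.card_fin M)
      have h2 : |c * ((freshInterval η s h τ ω).delivered.card : ℝ)| ≤ M := by
        rw [abs_mul, Nat.abs_cast]
        exact (mul_le_of_le_one_left (by positivity) hc).trans h1
      refine (abs_sub _ _).trans ?_
      have := abs_add_le b ε
      rw [abs_of_pos hε] at this
      linarith
  -- The expectation of `Z r` shrinks at least by the factor `q` in every interval.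
  set Z : ℕ → ChannelSpace N M → ℝ := fun r ω =>
    Real.exp (∑ k ∈ Finset.range r, l * (c * ((deliveredIn τ η s ω k).card : ℝ) - (b + ε))) with hZ
  have hdep : ∀ r, DependsOn (Z r) {e | e.1 < r * τ} := by
    intro r ω ω' hω
    simp only [hZ]
    congr 1
    refine Finset.sum_congr rfl fun k hk => ?_
    have hk := Finset.mem_range.1 hk
    have h1 : deliveredIn τ η s ω k = deliveredIn τ η s ω' k :=
      dependsOn_deliveredIn τ η s k fun e (he : e.1 < (k + 1) * τ) =>
        hω e (he.trans_le (Nat.mul_le_mul_right τ hk))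
    rw [h1]
  have hmom : ∀ r, ∫ ω, Z r ω ∂channelMeasure p ≤ q ^ r := by
    intro r
    induction r with
    | zero => simp [hZ]
    | succ r ih =>
      have hsp : ∀ ω ω', Z (r + 1) (splice (r * τ) ω ω') = Z r ω *
          Real.exp (l * (c * ((freshInterval η s (historyBefore τ η s ω r) τ ω').delivered.card : ℝ)
            - (b + ε))) := by
        intro ω ω'
        simp only [hZ, Finset.sum_range_succ, Real.exp_add, deliveredIn_splice]
        congr 2
        refine Finset.sum_congr rfl fun k hk => ?_
        rw [deliveredIn_splice_of_lt τ η s (Finset.mem_range.1 hk)]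
      rw [integral_splice p (hdep (r + 1)) (r * τ)]
      simp_rw [hsp, integral_const_mul]
      calc _ ≤ ∫ ω, Z r ω * q ∂channelMeasure p := by
            refine integral_mono ?_ (((hdep r).integrable_of_slots p).mul_const q) fun ω =>
              mul_le_mul_of_nonneg_left (hstep _) (Real.exp_pos _).le
            refine DependsOn.integrable_of_slots (n := r * τ) p fun ω ω' hω => ?_
            have h1 := dependsOn_historyBefore τ η s r hω
            simp only at h1
            rw [hdep r hω, h1]
        _ = (∫ ω, Z r ω ∂channelMeasure p) * q := integral_mul_const _ _
        _ ≤ q ^ (r + 1) := by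
            rw [pow_succ]; exact mul_le_mul_of_nonneg_right ih hq0
  have hsum : ∫⁻ ω, ∑' r, ENNReal.ofReal (Z r ω) ∂channelMeasure p ≠ ⊤ := by
    rw [lintegral_tsum fun r =>
      ((hdep r).measurable_of_slots.ennreal_ofReal).aemeasurable]
    have h1 : ∀ r, ∫⁻ ω, ENNReal.ofReal (Z r ω) ∂channelMeasure p ≤ ENNReal.ofReal (q ^ r) := by
      intro r
      rw [← ofReal_integral_eq_lintegral_ofReal ((hdep r).integrable_of_slots p)
        (ae_of_all _ fun ω => (Real.exp_pos _).le)]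
      exact ENNReal.ofReal_le_ofReal (hmom r)
    refine ne_top_of_le_ne_top ?_ (ENNReal.tsum_le_tsum h1)
    rw [← ENNReal.ofReal_tsum_of_nonneg (fun r => pow_nonneg hq0 r)
      (summable_geometric_of_lt_one hq0 hq1)]
    exact ENNReal.ofReal_ne_top
  have hmeas : Measurable fun ω => ∑' r, ENNReal.ofReal (Z r ω) :=
    Measurable.tsum fun r => (hdep r).measurable_of_slots.ennreal_ofReal
  filter_upwards [ae_lt_top hmeas hsum] with ω hω
  have ht := ENNReal.tendsto_atTop_zero_of_tsum_ne_top hω.ne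
  filter_upwards [ht.eventually (gt_mem_nhds zero_lt_one)] with r hr
  have h1 : Z r ω < 1 := by
    rw [← ENNReal.ofReal_one] at hr
    exact (ENNReal.ofReal_lt_ofReal_iff one_pos).1 hr
  rw [hZ, Real.exp_lt_one_iff, ← Finset.mul_sum, Finset.sum_sub_distrib, Finset.sum_const,
    Finset.card_range, nsmul_eq_mul] at h1
  have h2 := neg_of_mul_neg_right h1 hl0.le
  linarith

end StrongLaw

/-! ### Almost sure bounds on the long-term average -/

section LongTermAverage

variable {N M : ℕ} {S : Type*} [MeasurableSpace S]

lemma sum_deliveryIndicator (τ : ℕ) (η : Policy N M S) (s : S) (ω : ChannelSpace N M) (k : ℕ) :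
    ∑ j, deliveryIndicator τ η s ω k j = ((deliveredIn τ η s ω k).card : ℝ) := by
  simp [deliveryIndicator]

lemma average_nonneg (τ : ℕ) (η : Policy N M S) (s : S) (ω : ChannelSpace N M) (r : ℕ) :
    0 ≤ (∑ k ∈ Finset.range r, ∑ j : Fin M, deliveryIndicator τ η s ω k j) / (r : ℝ) := by
  simp_rw [sum_deliveryIndicator]
  positivity

lemma average_le (τ : ℕ) (η : Policy N M S) (s : S) (ω : ChannelSpace N M) (r : ℕ) :
    (∑ k ∈ Finset.range r, ∑ j : Fin M, deliveryIndicator τ η s ω k j) / (r : ℝ) ≤ M := by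
  simp_rw [sum_deliveryIndicator]
  refine div_le_of_le_mul₀ (by positivity) (by positivity) ?_
  calc _ ≤ ∑ k ∈ Finset.range r, (M : ℝ) := Finset.sum_le_sum fun k _ => by
        exact_mod_cast (Finset.card_le_univ _).trans_eq (Fintype.card_fin M)
    _ = M * r := by simp [mul_comm]

lemma ae_pathThroughput_le (p : Fin N → Fin M → unitInterval) (τ : ℕ) (η : Policy N M S) (s : S)
    {b : ℝ}
    (hb : ∀ h, ∫ ω, ((freshInterval η s h τ ω).delivered.card : ℝ) ∂channelMeasure p ≤ b) :
    ∀ᵐ ω ∂channelMeasure p, pathThroughput τ η s ω ≤ b := by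
  have h : ∀ n : ℕ, ∀ᵐ ω ∂channelMeasure p, ∀ᶠ r : ℕ in atTop,
      ∑ k ∈ Finset.range r, 1 * ((deliveredIn τ η s ω k).card : ℝ) ≤ r * (b + 1 / (n + 1)) :=
    fun n => ae_eventually_sum_le p τ η s (by simp) (by simpa using hb) (by positivity)
  filter_upwards [ae_all_iff.2 h] with ω hω
  refine le_of_forall_pos_le_add fun ε hε => ?_
  obtain ⟨n, hn⟩ := exists_nat_one_div_lt hε
  refine limsup_le_of_le (isCoboundedUnder_le_of_le _ (average_nonneg τ η s ω)) ?_
  filter_upwards [hω n, eventually_gt_atTop 0] with r hr hr0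
  have hr0 : (0 : ℝ) < r := by exact_mod_cast hr0
  simp_rw [sum_deliveryIndicator]
  rw [div_le_iff₀ hr0]
  simp only [one_mul] at hr
  nlinarith

lemma ae_le_pathThroughput (p : Fin N → Fin M → unitInterval) (τ : ℕ) (η : Policy N M S) (s : S)
    {b : ℝ}
    (hb : ∀ h, b ≤ ∫ ω, ((freshInterval η s h τ ω).delivered.card : ℝ) ∂channelMeasure p) :
    ∀ᵐ ω ∂channelMeasure p, b ≤ pathThroughput τ η s ω := by
  have h : ∀ n : ℕ, ∀ᵐ ω ∂channelMeasure p, ∀ᶠ r : ℕ in atTop,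
      ∑ k ∈ Finset.range r, (-1) * ((deliveredIn τ η s ω k).card : ℝ) ≤ r * (-b + 1 / (n + 1)) :=
    fun n => ae_eventually_sum_le p τ η s (by simp)
      (fun h => by rw [integral_const_mul]; linarith [hb h]) (by positivity)
  filter_upwards [ae_all_iff.2 h] with ω hω
  refine le_of_forall_pos_sub_le fun ε hε => ?_
  obtain ⟨n, hn⟩ := exists_nat_one_div_lt hε
  refine le_limsup_of_frequently_le (Eventually.frequently ?_)
    (isBoundedUnder_of ⟨M, average_le τ η s ω⟩)
  filter_upwards [hω n, eventually_gt_atTop 0] with r hr hr0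
  have hr0 : (0 : ℝ) < r := by exact_mod_cast hr0
  simp_rw [sum_deliveryIndicator]
  rw [le_div_iff₀ hr0]
  rw [← Finset.mul_sum] at hr
  nlinarith

end LongTermAverage

/-! ### The fractional knapsack problem -/

section Knapsack

/-- The linear relaxation of a knapsack problem with unit profits exceeds the 0-1 optimum by less
than `1`, uniformly over the feasible fractional solutions. If `k` is the optimum, the `k + 1`
lightest items do not fit, and any fractional solution of value `k + 1` weighs at least as
much as they do. -/
lemma exists_fractional_knapsack_bound {ι : Type*} (J : Finset ι) (w : ι → ℝ)
    (hw : ∀ j ∈ J, 0 < w j) {τ : ℝ} (hτ : 0 ≤ τ) :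
    ∃ T ⊆ J, ∑ j ∈ T, w j ≤ τ ∧ ∃ c < (T.card : ℝ) + 1, ∀ y : ι → ℝ,
      (∀ j ∈ J, 0 ≤ y j ∧ y j ≤ 1) → ∑ j ∈ J, y j * w j ≤ τ → ∑ j ∈ J, y j ≤ c := by
  classical
  obtain ⟨T, hT, hTmax⟩ := Finset.exists_max_image (J.powerset.filter fun T => ∑ j ∈ T, w j ≤ τ)
    Finset.card ⟨∅, by simp [hτ]⟩
  rw [Finset.mem_filter, Finset.mem_powerset] at hT
  refine ⟨T, hT.1, hT.2, ?_⟩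
  by_cases hJ : J.card ≤ T.card
  · refine ⟨T.card, by linarith, fun y hy _ => ?_⟩
    calc ∑ j ∈ J, y j ≤ ∑ j ∈ J, (1 : ℝ) := Finset.sum_le_sum fun j hj => (hy j hj).2
      _ ≤ T.card := by simpa using hJ
  -- `A` is a lightest set of `k + 1` items, and `a` its heaviest element.
  obtain ⟨A, hA, hAmin⟩ := Finset.exists_min_image (J.powersetCard (T.card + 1))
    (fun A => ∑ j ∈ A, w j) (Finset.powersetCard_nonempty.2 (by omega))
  rw [Finset.mem_powersetCard] at hA
  have hAτ : τ < ∑ j ∈ A, w j := by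
    by_contra hcon
    have := hTmax A (Finset.mem_filter.2 ⟨Finset.mem_powerset.2 hA.1, not_lt.1 hcon⟩)
    omega
  obtain ⟨a, ha, hamax⟩ := Finset.exists_max_image A w (Finset.card_pos.1 (by omega))
  have hwa := hw a (hA.1 ha)
  have hout : ∀ j ∈ J \ A, w a ≤ w j := by
    intro j hj
    rw [Finset.mem_sdiff] at hj
    have hj' : j ∉ A.erase a := fun h => hj.2 (Finset.mem_of_mem_erase h)
    have h1 := hAmin (insert j (A.erase a)) (Finset.mem_powersetCard.2 ⟨?_, ?_⟩)
    · rw [Finset.sum_insert hj', ← Finset.add_sum_erase A w ha] at h1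
      linarith
    · exact Finset.insert_subset hj.1 ((Finset.erase_subset _ _).trans hA.1)
    · rw [Finset.card_insert_of_notMem hj', Finset.card_erase_of_mem ha]
      omega
  refine ⟨T.card + 1 - (∑ j ∈ A, w j - τ) / w a, ?_, fun y hy hyτ => ?_⟩
  · have : 0 < (∑ j ∈ A, w j - τ) / w a := div_pos (by linarith) hwa
    linarith
  have h1 : ∑ j ∈ J \ A, y j * w a ≤ ∑ j ∈ J \ A, y j * w j := Finset.sum_le_sum fun j hj =>
    mul_le_mul_of_nonneg_left (hout j hj) (hy j (Finset.mem_sdiff.1 hj).1).1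
  have h2 : ∑ j ∈ A, (1 - y j) * w j ≤ ∑ j ∈ A, (1 - y j) * w a := Finset.sum_le_sum fun j hj =>
    mul_le_mul_of_nonneg_left (hamax j hj) (by linarith [(hy j (hA.1 hj)).2])
  rw [← Finset.sum_sdiff hA.1] at hyτ ⊢
  rw [← Finset.sum_mul] at h1
  simp_rw [sub_mul, Finset.sum_sub_distrib, one_mul, ← Finset.sum_mul] at h2
  rw [Finset.sum_const, hA.2, nsmul_eq_mul] at h2
  push_cast at h2
  rw [le_sub_iff_add_le, ← le_sub_iff_add_le', div_le_iff₀ hwa]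
  nlinarith

end Knapsack

/-! ### Packings as families of sets -/

section Packings

variable {N M : ℕ}

lemma IsPacking.sum_le {τ : ℕ} {p : Fin N → Fin M → unitInterval} {x : Fin N → Fin M → ℕ}
    (hx : IsPacking τ p x) : ∑ i, ∑ j, x i j ≤ M := by
  rw [Finset.sum_comm]
  calc _ ≤ ∑ _j : Fin M, 1 := Finset.sum_le_sum fun j _ => hx.at_most_once j
    _ = M := by simp

lemma bddAbove_packingValues (τ : ℕ) (p : Fin N → Fin M → unitInterval) :
    BddAbove {n : ℕ | ∃ x : Fin N → Fin M → ℕ, IsPacking τ p x ∧ n = ∑ i, ∑ j, x i j} := by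
  refine ⟨M, ?_⟩
  rintro _ ⟨x, hx, rfl⟩
  exact hx.sum_le

/-- Disjoint sets of clients that fit into the access points form a packing. -/
lemma sum_card_le_packingOptimum {τ : ℕ} {p : Fin N → Fin M → unitInterval}
    (a : Assignment N M) (T : Fin N → Finset (Fin M))
    (hT : ∀ i, ∀ j ∈ T i, a j = i ∧ 0 < (p i j : ℝ))
    (hcap : ∀ i, ∑ j ∈ T i, 1 / (p i j : ℝ) ≤ τ) :
    ∑ i, (T i).card ≤ packingOptimum τ p := by
  refine le_csSup (bddAbove_packingValues τ p)
    ⟨fun i j => if j ∈ T i then 1 else 0, ⟨?_, ?_, ?_⟩, ?_⟩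
  · intro i j
    split_ifs <;> simp
  · intro i
    calc ∑ j, (((if j ∈ T i then 1 else 0 : ℕ) : ENNReal)) / ENNReal.ofReal (p i j : ℝ)
        = ∑ j, if j ∈ T i then ENNReal.ofReal (1 / (p i j : ℝ)) else 0 := by
          refine Finset.sum_congr rfl fun j _ => ?_
          split_ifs with hj
          · rw [ENNReal.ofReal_div_of_pos (hT i j hj).2]; simp
          · simp
      _ = ENNReal.ofReal (∑ j ∈ T i, 1 / (p i j : ℝ)) := by
          rw [ENNReal.ofReal_sum_of_nonneg fun j hj => by have := (hT i j hj).2; positivity]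
          simp
      _ ≤ τ := by
          rw [← ENNReal.ofReal_natCast]
          exact ENNReal.ofReal_le_ofReal (hcap i)
  · intro j
    calc _ ≤ ∑ i, if i = a j then 1 else 0 := by
          refine Finset.sum_le_sum fun i _ => ?_
          by_cases hj : j ∈ T i
          · simp [hj, (hT i j hj).1]
          · simp [hj]
      _ = 1 := by simp
  · simp

/-- An optimal packing, as an assignment together with disjoint sets of clients that fit into
the access points. -/
lemma exists_optimal_packing (hN : 1 ≤ N) (τ : ℕ) (p : Fin N → Fin M → unitInterval) :
    ∃ (a : Assignment N M) (J : Fin N → Finset (Fin M)),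
      (∀ i, ∀ j ∈ J i, a j = i ∧ 0 < (p i j : ℝ)) ∧
      (∀ i, ∑ j ∈ J i, 1 / (p i j : ℝ) ≤ τ) ∧ ∑ i, (J i).card = packingOptimum τ p := by
  classical
  obtain ⟨x, hx, hsum⟩ := Nat.sSup_mem
    (s := {n : ℕ | ∃ x : Fin N → Fin M → ℕ, IsPacking τ p x ∧ n = ∑ i, ∑ j, x i j})
    ⟨0, 0, ⟨by simp, by simp, by simp⟩, by simp⟩ (bddAbove_packingValues τ p)
  have hterm : ∀ i j, x i j = 1 → 1 / ENNReal.ofReal (p i j : ℝ) ≤ τ := by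
    intro i j hij
    have h1 := (Finset.single_le_sum (f := fun j => (x i j : ENNReal) / ENNReal.ofReal (p i j : ℝ))
      (fun _ _ => zero_le) (Finset.mem_univ j)).trans (hx.capacity i)
    simpa [hij] using h1
  have hpos : ∀ i j, x i j = 1 → 0 < (p i j : ℝ) := by
    intro i j hij
    refine lt_of_le_of_ne (p i j).2.1 fun h0 => ?_
    have h1 := hterm i j hij
    rw [← h0] at h1
    simp at h1
  refine ⟨fun j => if h : ∃ i, x i j = 1 then h.choose else ⟨0, hN⟩,
    fun i => Finset.univ.filter fun j => x i j = 1, ?_, ?_, ?_⟩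
  · intro i j hj
    have hj : x i j = 1 := by simpa using hj
    refine ⟨?_, hpos i j hj⟩
    have hex : ∃ i, x i j = 1 := ⟨i, hj⟩
    simp only [hex, dif_pos]
    by_contra hne
    have h1 := hx.at_most_once j
    have h2 : x hex.choose j + x i j ≤ ∑ i, x i j := by
      rw [← Finset.sum_pair (f := fun i => x i j) hne]
      exact Finset.sum_le_sum_of_subset (Finset.subset_univ _)
    have h3 := hex.choose_spec
    omega
  · intro i
    have h1 := hx.capacity i
    rw [← ENNReal.ofReal_natCast] at h1
    rw [← ENNReal.ofReal_le_ofReal_iff (by positivity)]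
    refine le_trans (le_of_eq ?_) h1
    rw [ENNReal.ofReal_sum_of_nonneg fun j hj => one_div_nonneg.2 (p i j).2.1, Finset.sum_filter]
    refine Finset.sum_congr rfl fun j _ => ?_
    rcases hx.zero_or_one i j with h | h
    · simp [h]
    · rw [if_pos h, ENNReal.ofReal_div_of_pos (hpos i j h)]
      simp [h]
  · rw [packingOptimum, hsum]
    refine Finset.sum_congr rfl fun i _ => ?_
    rw [Finset.card_filter]
    refine Finset.sum_congr rfl fun j _ => ?_
    rcases hx.zero_or_one i j with h | h <;> simp [h]

end Packings

/-! ### Expected deliveries in an interval: upper bound -/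

section UpperBound

variable {N M : ℕ} {S : Type*} [MeasurableSpace S]

lemma transmission_eq_some {η : Policy N M S} {s : S} {st : SysState N M} {i : Fin N} {j : Fin M}
    (h : transmission η s st i = some j) : st.assignment j = i ∧ j ∉ st.delivered := by
  rw [transmission, Option.filter_eq_some_iff] at h
  simpa using h.2

lemma mem_delivered_slotStep {η : Policy N M S} {s : S} {c : Fin N → Fin M → Bool}
    {st : SysState N M} {j : Fin M} :
    j ∈ (slotStep η s c st).delivered ↔ j ∈ st.delivered ∨
      (transmission η s st (st.assignment j) = some j ∧ c (st.assignment j) j = true) := by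
  simp only [slotStep, Finset.mem_union, Finset.mem_filter, Finset.mem_univ, true_and]
  refine or_congr_right ⟨?_, fun h => ⟨_, h⟩⟩
  rintro ⟨i, hi, hc⟩
  rw [(transmission_eq_some hi).1]
  exact ⟨hi, hc⟩

/-- The probability that client `j` has been served after `t` slots of an interval. -/
noncomputable def deliveryProb (p : Fin N → Fin M → unitInterval) (η : Policy N M S) (s : S)
    (h : History N M) (t : ℕ) (j : Fin M) : ℝ :=
  ∫ ω, (if j ∈ (freshInterval η s h t ω).delivered then 1 else 0) ∂channelMeasure p

/-- The expected number of transmissions to client `j` in the first `t` slots of an interval. -/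
noncomputable def expectedTransmissions (p : Fin N → Fin M → unitInterval) (η : Policy N M S)
    (s : S) (h : History N M) (t : ℕ) (j : Fin M) : ℝ :=
  ∑ u ∈ Finset.range t,
    ∫ ω, (if transmission η s (freshInterval η s h u ω) (η.assign s h j) = some j then 1 else 0)
      ∂channelMeasure p

/-- Wald's identity: every transmission succeeds with the same probability, whatever the past. -/
lemma deliveryProb_eq (p : Fin N → Fin M → unitInterval) (η : Policy N M S) (s : S)
    (h : History N M) (t : ℕ) (j : Fin M) :
    deliveryProb p η s h t j
      = (p (η.assign s h j) j : ℝ) * expectedTransmissions p η s h t j := by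
  induction t with
  | zero => simp [deliveryProb, expectedTransmissions, freshInterval, runInterval, startInterval]
  | succ t ih =>
    set i := η.assign s h j with hi
    rw [expectedTransmissions, Finset.sum_range_succ, mul_add, ← expectedTransmissions, ← ih,
      deliveryProb,
      integral_freshInterval_succ p η s h t fun st => if j ∈ st.delivered then 1 else 0]
    have hstep : ∀ ω, ∫ ω', (if j ∈ (slotStep η s (fun i j => ω' (0, i, j))
        (freshInterval η s h t ω)).delivered then (1 : ℝ) else 0) ∂channelMeasure p
        = (if j ∈ (freshInterval η s h t ω).delivered then 1 else 0) +
          (p i j : ℝ) * (if transmission η s (freshInterval η s h t ω) i = some j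
            then 1 else 0) := by
      intro ω
      simp_rw [mem_delivered_slotStep, freshInterval_assignment, ← hi]
      by_cases htr : transmission η s (freshInterval η s h t ω) i = some j
      · have := (transmission_eq_some htr).2
        simp only [htr, this, true_and, false_or, if_true, if_false]
        rw [integral_channel p (0, i, j) fun b => if b = true then 1 else 0]
        simp
      · simp [htr]
    simp_rw [hstep]
    rw [integral_add
      (integrable_freshInterval p η s h t fun st => if j ∈ st.delivered then 1 else 0)
      (Integrable.const_mul (integrable_freshInterval p η s h t fun st =>
        if transmission η s st i = some j then 1 else 0) _), integral_const_mul, deliveryProb]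

lemma deliveryProb_mem (p : Fin N → Fin M → unitInterval) (η : Policy N M S) (s : S)
    (h : History N M) (t : ℕ) (j : Fin M) :
    0 ≤ deliveryProb p η s h t j ∧ deliveryProb p η s h t j ≤ 1 := by
  constructor
  · exact integral_nonneg fun ω => by dsimp only; split_ifs <;> simp
  · calc _ ≤ ∫ _, (1 : ℝ) ∂channelMeasure p :=
          integral_mono (integrable_freshInterval p η s h t fun st =>
            if j ∈ st.delivered then 1 else 0) (integrable_const _)
            fun ω => by dsimp only; split_ifs <;> simp
      _ = 1 := by simp

/-- An access point makes at most one transmission per slot. -/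
lemma sum_expectedTransmissions_le (p : Fin N → Fin M → unitInterval) (η : Policy N M S) (s : S)
    (h : History N M) (t : ℕ) (i : Fin N) (J : Finset (Fin M)) (hJ : ∀ j ∈ J, η.assign s h j = i) :
    ∑ j ∈ J, expectedTransmissions p η s h t j ≤ t := by
  simp only [expectedTransmissions]
  rw [Finset.sum_comm]
  calc _ ≤ ∑ u ∈ Finset.range t, (1 : ℝ) := Finset.sum_le_sum fun u _ => ?_
    _ = t := by simp
  have hint : ∀ j, Integrable (fun ω => if transmission η s (freshInterval η s h u ω)
      (η.assign s h j) = some j then (1 : ℝ) else 0) (channelMeasure p) := fun j =>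
    integrable_freshInterval p η s h u fun st =>
      if transmission η s st (η.assign s h j) = some j then 1 else 0
  rw [← integral_finsetSum _ fun j _ => hint j]
  calc _ ≤ ∫ _, (1 : ℝ) ∂channelMeasure p :=
        integral_mono (integrable_finsetSum _ fun j _ => hint j) (integrable_const _) fun ω => ?_
    _ = 1 := by simp
  set o := transmission η s (freshInterval η s h u ω) i with ho
  calc _ = ∑ j ∈ J, if o = some j then (1 : ℝ) else 0 :=
        Finset.sum_congr rfl fun j hj => by rw [hJ j hj]
    _ ≤ 1 := by
      cases o with
      | none => simp
      | some j' =>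
        simp only [Option.some.injEq, Finset.sum_ite_eq]
        split_ifs <;> simp

lemma integral_card_delivered (p : Fin N → Fin M → unitInterval) (η : Policy N M S) (s : S)
    (h : History N M) (t : ℕ) :
    ∫ ω, ((freshInterval η s h t ω).delivered.card : ℝ) ∂channelMeasure p
      = ∑ j, deliveryProb p η s h t j := by
  simp only [deliveryProb]
  rw [← integral_finsetSum _ fun j _ => integrable_freshInterval p η s h t fun st =>
    if j ∈ st.delivered then 1 else 0]
  simp

/-- For a fixed assignment `a`, delivery probabilities `y` and expected numbers of transmissions `u`
that satisfy Wald's identity and the capacity constraints have a total delivery probability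
uniformly below the packing optimum plus the number of access points. Clients with a dead
channel are not part of the knapsack problems, and `y` vanishes on them. -/
lemma exists_assignment_bound (hN : 1 ≤ N) (τ : ℕ) (p : Fin N → Fin M → unitInterval)
    (a : Assignment N M) :
    ∃ b < (packingOptimum τ p : ℝ) + N, ∀ u y : Fin M → ℝ, (∀ j, 0 ≤ y j ∧ y j ≤ 1) →
      (∀ j, y j = (p (a j) j : ℝ) * u j) →
      (∀ i (J : Finset (Fin M)), (∀ j ∈ J, a j = i) → ∑ j ∈ J, u j ≤ τ) → ∑ j, y j ≤ b := by
  set J : Fin N → Finset (Fin M) := fun i =>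
    Finset.univ.filter fun j => a j = i ∧ 0 < (p i j : ℝ) with hJdef
  have hJ : ∀ i, ∀ j ∈ J i, a j = i ∧ 0 < (p i j : ℝ) := fun i j hj => by simpa [hJdef] using hj
  choose T hTJ hTτ c hc hbound using fun i => exists_fractional_knapsack_bound (J i)
    (fun j => 1 / (p i j : ℝ)) (fun j hj => one_div_pos.2 (hJ i j hj).2)
    (τ := (τ : ℝ)) (by positivity)
  refine ⟨∑ i, c i, ?_, fun u y hy hyu hcap => ?_⟩
  · have h1 : ∑ i, c i < ∑ i, (((T i).card : ℝ) + 1) :=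
      Finset.sum_lt_sum_of_nonempty ⟨⟨0, hN⟩, Finset.mem_univ _⟩ fun i _ => hc i
    have h2 : ((∑ i, (T i).card : ℕ) : ℝ) ≤ packingOptimum τ p := by
      exact_mod_cast sum_card_le_packingOptimum a T (fun i j hj => hJ i j (hTJ i hj)) hTτ
    rw [Finset.sum_add_distrib] at h1
    push_cast at h2
    simp only [Finset.sum_const, Finset.card_univ, Fintype.card_fin, nsmul_eq_mul, mul_one] at h1
    linarith
  · rw [← Finset.sum_fiberwise Finset.univ a y]
    refine Finset.sum_le_sum fun i _ => ?_
    have h1 : ∑ j ∈ Finset.univ.filter (fun j => a j = i), y j = ∑ j ∈ J i, y j := by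
      refine (Finset.sum_subset (fun j hj => ?_) fun j hj hj' => ?_).symm
      · simp [(hJ i j hj).1]
      · have hj : a j = i := by simpa using hj
        have h0 : (p i j : ℝ) = 0 := by
          refine le_antisymm (not_lt.1 fun hpos => hj' ?_) (p i j).2.1
          exact Finset.mem_filter.2 ⟨Finset.mem_univ _, hj, hpos⟩
        rw [hyu j, hj, h0, zero_mul]
    rw [h1]
    refine hbound i y (fun j _ => hy j) ?_
    refine le_trans (le_of_eq ?_) (hcap i (J i) fun j hj => (hJ i j hj).1)
    refine Finset.sum_congr rfl fun j hj => ?_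
    have hpos := (hJ i j hj).2
    rw [hyu j, (hJ i j hj).1]
    field_simp

/-- The expected number of deliveries in an interval is uniformly below the optimum of the packing
problem plus the number of access points. -/
lemma exists_uniform_bound (hN : 1 ≤ N) (τ : ℕ) (p : Fin N → Fin M → unitInterval) :
    ∃ b < (packingOptimum τ p : ℝ) + N, ∀ (η : Policy N M S) (s : S) (h : History N M),
      ∫ ω, ((freshInterval η s h τ ω).delivered.card : ℝ) ∂channelMeasure p ≤ b := by
  choose b hb hbound using exists_assignment_bound hN τ p
  have : Nonempty (Assignment N M) := ⟨fun _ => ⟨0, hN⟩⟩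
  obtain ⟨a₀, ha₀⟩ := Finite.exists_max b
  refine ⟨b a₀, hb a₀, fun η s h => ?_⟩
  rw [integral_card_delivered]
  refine (hbound (η.assign s h) (expectedTransmissions p η s h τ) _
    (deliveryProb_mem p η s h τ) (deliveryProb_eq p η s h τ)
    (sum_expectedTransmissions_le p η s h τ)).trans (ha₀ _)

end UpperBound

/-! ### The service potential -/

section Potential

variable {ι : Type*} [DecidableEq ι]

/-- The potential of an access point that serves the clients `J` in the order of decreasing
success probability `q`, when `t` slots have elapsed and the clients `U` are still to be served:
`|U|` plus the square of the delay against the expected schedule, measured in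
units of the expected service time of the current client. -/
noncomputable def servicePotential (q : ι → unitInterval) (J : Finset ι) (t : ℝ) (U : Finset ι) :
    ℝ :=
  ((t - ∑ j ∈ J \ U, 1 / (q j : ℝ)) * (U.sup q : unitInterval)) ^ 2 + U.card

lemma servicePotential_empty (q : ι → unitInterval) (J : Finset ι) (t : ℝ) :
    servicePotential q J t ∅ = 0 := by simp [servicePotential]

lemma servicePotential_self (q : ι → unitInterval) (J : Finset ι) :
    servicePotential q J 0 J = J.card := by simp [servicePotential]

/-- The potential is a supermartingale when the best unserved client `j` is served. With `A` the
delay and `q` the success probability of `j`, the square of `A * q` becomes on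
average at most `(A * q) ^ 2 + q - q ^ 2`, as the unit of time can only grow, while `|U|`
decreases by `q` on average. -/
lemma servicePotential_step (q : ι → unitInterval) {J U : Finset ι} (hU : U ⊆ J) {j : ι}
    (hj : j ∈ U) (hsup : U.sup q = q j) (hpos : 0 < (q j : ℝ)) (t : ℝ) :
    (q j : ℝ) * servicePotential q J (t + 1) (U.erase j)
      + (1 - (q j : ℝ)) * servicePotential q J (t + 1) U ≤ servicePotential q J t U := by
  have hsd : J \ U.erase j = insert j (J \ U) := by
    ext k
    simp only [Finset.mem_sdiff, Finset.mem_erase, Finset.mem_insert]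
    have := @hU j hj
    by_cases hk : k = j
    · subst hk; simp [this]
    · simp [hk]
  have hcard : ((U.erase j).card : ℝ) = U.card - 1 := by
    rw [Finset.card_erase_of_mem hj, Nat.cast_pred (Finset.card_pos.2 ⟨j, hj⟩)]
  have hmono : (((U.erase j).sup q : unitInterval) : ℝ) ≤ q j := by
    rw [← hsup]
    exact (Finset.sup_mono (U.erase_subset j) : (U.erase j).sup q ≤ U.sup q)
  have hnn : 0 ≤ (((U.erase j).sup q : unitInterval) : ℝ) := ((U.erase j).sup q).2.1
  simp only [servicePotential, hsup, hsd, hcard]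
  rw [Finset.sum_insert (by simp [hj])]
  set x : ℝ := (q j : ℝ)
  set m : ℝ := (((U.erase j).sup q : unitInterval) : ℝ)
  set A := t - ∑ k ∈ J \ U, 1 / (q k : ℝ) with hA
  have e1 : t + 1 - (1 / x + ∑ k ∈ J \ U, 1 / (q k : ℝ)) = A + 1 - 1 / x := by rw [hA]; ring
  have e2 : t + 1 - ∑ k ∈ J \ U, 1 / (q k : ℝ) = A + 1 := by rw [hA]; ring
  rw [e1, e2]
  have h1 : ((A + 1 - 1 / x) * m) ^ 2 ≤ ((A + 1 - 1 / x) * x) ^ 2 := by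
    rw [mul_pow, mul_pow]
    exact mul_le_mul_of_nonneg_left (pow_le_pow_left₀ hnn hmono 2) (sq_nonneg _)
  have h2 : (A + 1 - 1 / x) * x = (A + 1) * x - 1 := by field_simp
  rw [h2] at h1
  have h3 := mul_le_mul_of_nonneg_left h1 hpos.le
  nlinarith [sq_nonneg x]

/-- At the end of an interval that is long enough on average, the potential dominates the square
of the number of unserved clients. -/
lemma sq_card_le_servicePotential (q : ι → unitInterval) {J U : Finset ι} (hU : U ⊆ J)
    (hq : ∀ j ∈ J, 0 < (q j : ℝ)) {t : ℝ} (ht : ∑ j ∈ J, 1 / (q j : ℝ) ≤ t) :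
    (U.card : ℝ) ^ 2 ≤ servicePotential q J t U := by
  have h1 : (U.card : ℝ) ≤ (t - ∑ j ∈ J \ U, 1 / (q j : ℝ)) * (U.sup q : unitInterval) := by
    calc (U.card : ℝ) = ∑ j ∈ U, 1 := by simp
      _ ≤ ∑ j ∈ U, 1 / (q j : ℝ) * (U.sup q : unitInterval) := Finset.sum_le_sum fun j hj => by
          have h2 : (q j : ℝ) ≤ (U.sup q : unitInterval) := Finset.le_sup (f := q) hj
          rw [one_div_mul_eq_div, le_div_iff₀ (hq j (hU hj))]
          linarith
      _ ≤ _ := by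
          rw [← Finset.sum_mul]
          refine mul_le_mul_of_nonneg_right ?_ (U.sup q).2.1
          rw [← Finset.sum_sdiff hU] at ht
          linarith
  have h2 := pow_le_pow_left₀ (Nat.cast_nonneg _) h1 2
  rw [servicePotential]
  have : (0 : ℝ) ≤ U.card := by positivity
  linarith

end Potential

/-! ### Expected deliveries in an interval: lower bound -/

section ServePolicy

variable {N M : ℕ} {S : Type*} [MeasurableSpace S]

/-- The clients served in the current interval, as recovered from the history. -/
def servedClients : History N M → Finset (Fin M)
  | [] => ∅
  | Event.assigned _ :: _ => ∅
  | Event.slot e :: h =>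
    servedClients h ∪ Finset.univ.filter fun j => ∃ i, e i = some (j, true)

/-- A client of `U` with the largest success probability, if there is one. -/
noncomputable def bestClient (q : Fin M → unitInterval) (U : Finset (Fin M)) : Option (Fin M) :=
  if h : U.Nonempty then some (Finset.exists_mem_eq_sup U h q).choose else none

lemma bestClient_eq_some {q : Fin M → unitInterval} {U : Finset (Fin M)} {j : Fin M}
    (h : bestClient q U = some j) : j ∈ U ∧ U.sup q = q j := by
  unfold bestClient at h
  split_ifs at h with hU
  rw [← Option.some.inj h]
  exact (Finset.exists_mem_eq_sup U hU q).choose_spec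

lemma bestClient_eq_none {q : Fin M → unitInterval} {U : Finset (Fin M)}
    (h : bestClient q U = none) : U = ∅ := by
  unfold bestClient at h
  split_ifs at h with hU
  exact Finset.not_nonempty_iff_eq_empty.1 hU

/-- The deterministic policy that uses the assignment `a` in every interval and lets access point
`i` transmit to its best unserved client within `J i`. -/
noncomputable def servePolicy (S : Type*) [MeasurableSpace S] (p : Fin N → Fin M → unitInterval)
    (a : Assignment N M) (J : Fin N → Finset (Fin M)) : Policy N M S where
  assign _ _ := a
  transmit _ h i := bestClient (p i) (J i \ servedClients h)
  measurable_assign _ _ := MeasurableSet.const _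
  measurable_transmit _ _ := MeasurableSet.const _

variable {p : Fin N → Fin M → unitInterval} {a : Assignment N M} {J : Fin N → Finset (Fin M)}

lemma servedClients_freshInterval (η : Policy N M S) (s : S) (h : History N M) (t : ℕ)
    (ω : ChannelSpace N M) :
    servedClients (freshInterval η s h t ω).history = (freshInterval η s h t ω).delivered := by
  induction t with
  | zero => rfl
  | succ t ih =>
    change servedClients (freshInterval η s h t ω).history ∪ _ = _ ∪ _
    rw [ih]
    congr 1
    ext j
    simp [Prod.ext_iff]

lemma transmission_servePolicy (hJ : ∀ i, ∀ j ∈ J i, a j = i) (s : S) (h : History N M) (t : ℕ)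
    (ω : ChannelSpace N M) (i : Fin N) :
    transmission (servePolicy S p a J) s (freshInterval (servePolicy S p a J) s h t ω) i
      = bestClient (p i) (J i \ (freshInterval (servePolicy S p a J) s h t ω).delivered) := by
  have ha : (freshInterval (servePolicy S p a J) s h t ω).assignment = a :=
    freshInterval_assignment _ _ _ _ _
  have htr : ∀ h', (servePolicy S p a J).transmit s h' i
      = bestClient (p i) (J i \ servedClients h') := fun _ => rfl
  rw [transmission, htr, servedClients_freshInterval, ha]
  cases hb : bestClient (p i) (J i \ (freshInterval (servePolicy S p a J) s h t ω).delivered) with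
  | none => rfl
  | some j =>
    have h1 := Finset.mem_sdiff.1 (bestClient_eq_some hb).1
    simp [Option.filter_some, hJ i j h1.1, h1.2]

lemma integral_servicePotential_succ_le (hJ : ∀ i, ∀ j ∈ J i, a j = i ∧ 0 < (p i j : ℝ)) (s : S)
    (h : History N M) (t : ℕ) (i : Fin N) :
    ∫ ω, servicePotential (p i) (J i) (t + 1 : ℕ)
        (J i \ (freshInterval (servePolicy S p a J) s h (t + 1) ω).delivered) ∂channelMeasure p
      ≤ ∫ ω, servicePotential (p i) (J i) t
        (J i \ (freshInterval (servePolicy S p a J) s h t ω).delivered) ∂channelMeasure p := by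
  set η := servePolicy S p a J
  rw [integral_freshInterval_succ p η s h t fun st =>
    servicePotential (p i) (J i) (t + 1 : ℕ) (J i \ st.delivered)]
  refine integral_mono ?_ (integrable_freshInterval p η s h t fun st =>
    servicePotential (p i) (J i) t (J i \ st.delivered)) fun ω => ?_
  · exact integrable_freshInterval p η s h t fun st => ∫ ω', servicePotential (p i) (J i)
      (t + 1 : ℕ) (J i \ (slotStep η s (fun i j => ω' (0, i, j)) st).delivered) ∂channelMeasure p
  set st := freshInterval η s h t ω with hst
  have hasg : st.assignment = a := freshInterval_assignment _ _ _ _ _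
  have htr : transmission η s st i = bestClient (p i) (J i \ st.delivered) :=
    transmission_servePolicy (fun i j hj => (hJ i j hj).1) s h t ω i
  -- The clients of `i` that remain after the slot depend only on the channel that `i` uses.
  have hrem : ∀ c : Fin N → Fin M → Bool, J i \ (slotStep η s c st).delivered
      = (J i \ st.delivered).filter fun k => ¬ (transmission η s st i = some k ∧ c i k = true) := by
    intro c
    ext k
    simp only [Finset.mem_sdiff, mem_delivered_slotStep, hasg, Finset.mem_filter, not_or]
    constructor
    · rintro ⟨h1, h2, h3⟩
      rw [(hJ i k h1).1] at h3
      exact ⟨⟨h1, h2⟩, h3⟩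
    · rintro ⟨⟨h1, h2⟩, h3⟩
      rw [(hJ i k h1).1]
      exact ⟨h1, h2, h3⟩
  cases hb : bestClient (p i) (J i \ st.delivered) with
  | none =>
    simp_rw [hrem, bestClient_eq_none hb, Finset.filter_empty, servicePotential_empty]
    simp
  | some j =>
    obtain ⟨hj, hsup⟩ := bestClient_eq_some hb
    set U := J i \ st.delivered
    have hrem' : ∀ ω' : ChannelSpace N M,
        J i \ (slotStep η s (fun i j => ω' (0, i, j)) st).delivered
          = if ω' (0, i, j) = true then U.erase j else U := by
      intro ω'
      rw [hrem, htr, hb]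
      ext k
      by_cases hk : k = j
      · subst hk; split_ifs with hc <;> simp [hc, hj]
      · have : j ≠ k := fun h => hk h.symm
        split_ifs with hc <;> simp [hk, this]
    simp_rw [hrem']
    rw [integral_channel p (0, i, j) fun b =>
      servicePotential (p i) (J i) (t + 1 : ℕ) (if b = true then U.erase j else U)]
    simpa using servicePotential_step (p i) Finset.sdiff_subset hj hsup
      (hJ i j (Finset.mem_sdiff.1 hj).1).2 (t : ℝ)

lemma integral_sq_card_unserved_le (hJ : ∀ i, ∀ j ∈ J i, a j = i ∧ 0 < (p i j : ℝ)) {τ : ℕ}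
    (hcap : ∀ i, ∑ j ∈ J i, 1 / (p i j : ℝ) ≤ τ) (s : S) (h : History N M) (i : Fin N) :
    ∫ ω, ((J i \ (freshInterval (servePolicy S p a J) s h τ ω).delivered).card : ℝ) ^ 2
      ∂channelMeasure p ≤ (J i).card := by
  have hmono : ∀ t : ℕ, ∫ ω, servicePotential (p i) (J i) t
      (J i \ (freshInterval (servePolicy S p a J) s h t ω).delivered) ∂channelMeasure p
        ≤ (J i).card := by
    intro t
    induction t with
    | zero => simp [freshInterval, runInterval, startInterval, servicePotential_self]
    | succ t ih => exact (integral_servicePotential_succ_le hJ s h t i).trans ih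
  refine le_trans (integral_mono ?_ ?_ fun ω => ?_) (hmono τ)
  · exact integrable_freshInterval p _ s h τ fun st => ((J i \ st.delivered).card : ℝ) ^ 2
  · exact integrable_freshInterval p _ s h τ fun st =>
      servicePotential (p i) (J i) τ (J i \ st.delivered)
  · exact sq_card_le_servicePotential (p i) Finset.sdiff_subset (fun j hj => (hJ i j hj).2)
      (hcap i)

/-- If the sets `J i` fit into the access points, serving them loses at most `c` packets per
interval on average, for any `c > 0` with `N * ∑ i, |J i| ≤ c ^ 2`. -/
lemma le_integral_card_delivered_servePolicy (hJ : ∀ i, ∀ j ∈ J i, a j = i ∧ 0 < (p i j : ℝ))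
    {τ : ℕ} (hcap : ∀ i, ∑ j ∈ J i, 1 / (p i j : ℝ) ≤ τ) {c : ℝ} (hc : 0 < c)
    (hNc : N * ∑ i, ((J i).card : ℝ) ≤ c ^ 2) (s : S) (h : History N M) :
    ∑ i, ((J i).card : ℝ) - c ≤
      ∫ ω, ((freshInterval (servePolicy S p a J) s h τ ω).delivered.card : ℝ)
        ∂channelMeasure p := by
  set η := servePolicy S p a J
  set L : Fin N → ChannelSpace N M → ℝ := fun i ω =>
    ((J i \ (freshInterval η s h τ ω).delivered).card : ℝ) with hL
  have hLsq : ∀ i, Integrable (fun ω => L i ω ^ 2) (channelMeasure p) := fun i =>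
    integrable_freshInterval p η s h τ fun st => ((J i \ st.delivered).card : ℝ) ^ 2
  have hpt : ∀ ω, ∑ i, ((J i).card : ℝ) - c / 2 - N / (2 * c) * ∑ i, L i ω ^ 2
      ≤ ((freshInterval η s h τ ω).delivered.card : ℝ) := by
    intro ω
    set D := (freshInterval η s h τ ω).delivered with hD
    have h1 : ∑ i, (J i ∩ D).card ≤ D.card := by
      rw [← Finset.card_biUnion]
      · exact Finset.card_le_card (Finset.biUnion_subset.2 fun i _ => Finset.inter_subset_right)
      · intro i _ i' _ hne
        refine Finset.disjoint_left.2 fun j hj hj' => hne ?_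
        rw [← (hJ i j (Finset.mem_inter.1 hj).1).1, (hJ i' j (Finset.mem_inter.1 hj').1).1]
    have h2 : ∑ i, ((J i).card : ℝ) = ((∑ i, (J i ∩ D).card : ℕ) : ℝ) + ∑ i, L i ω := by
      push_cast
      rw [← Finset.sum_add_distrib]
      refine Finset.sum_congr rfl fun i _ => ?_
      rw [← Finset.card_inter_add_card_sdiff (J i) D]
      push_cast
      rfl
    have h3 : (∑ i, L i ω) ^ 2 ≤ N * ∑ i, L i ω ^ 2 := by
      simpa using sq_sum_le_card_mul_sum_sq (s := Finset.univ) (f := fun i => L i ω)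
    -- The arithmetic-geometric mean inequality replaces the square root in Cauchy–Schwarz.
    have h4 : ∑ i, L i ω ≤ N / (2 * c) * (∑ i, L i ω ^ 2) + c / 2 := by
      rw [← sub_le_iff_le_add, div_mul_eq_mul_div, le_div_iff₀ (by positivity)]
      nlinarith [sq_nonneg (∑ i, L i ω - c)]
    have h5 : ((∑ i, (J i ∩ D).card : ℕ) : ℝ) ≤ D.card := by exact_mod_cast h1
    linarith
  have hsumi : Integrable (fun ω => ∑ i, L i ω ^ 2) (channelMeasure p) :=
    integrable_finsetSum _ fun i _ => hLsq i
  have hsum : ∫ ω, ∑ i, L i ω ^ 2 ∂channelMeasure p ≤ ∑ i, ((J i).card : ℝ) := by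
    rw [integral_finsetSum _ fun i _ => hLsq i]
    exact Finset.sum_le_sum fun i _ => integral_sq_card_unserved_le hJ hcap s h i
  have hint : Integrable (fun ω => ∑ i, ((J i).card : ℝ) - c / 2 - N / (2 * c) * ∑ i, L i ω ^ 2)
      (channelMeasure p) :=
    (integrable_const _).sub (hsumi.const_mul _)
  refine le_trans ?_ (integral_mono hint
    (integrable_freshInterval p η s h τ fun st => (st.delivered.card : ℝ)) hpt)
  rw [integral_sub (integrable_const _) (hsumi.const_mul _), integral_const_mul]
  simp only [integral_const, probReal_univ, one_smul]
  have h6 : N / (2 * c) * ∫ ω, ∑ i, L i ω ^ 2 ∂channelMeasure p ≤ c / 2 := by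
    rw [div_mul_eq_mul_div, div_le_iff₀ (by positivity)]
    have := mul_le_mul_of_nonneg_left hsum (Nat.cast_nonneg (α := ℝ) N)
    nlinarith
  linarith

lemma runInterval_servePolicy_seed (s s' : S) (c : ℕ → Fin N → Fin M → Bool) (h : History N M)
    (t : ℕ) : runInterval (servePolicy S p a J) s c h t
      = runInterval (servePolicy S p a J) s' c h t := by
  induction t with
  | zero => rfl
  | succ t ih => rw [runInterval, runInterval, ih]; rfl

lemma pathThroughput_servePolicy_seed (τ : ℕ) (s s' : S) (ω : ChannelSpace N M) :
    pathThroughput τ (servePolicy S p a J) s ω = pathThroughput τ (servePolicy S p a J) s' ω := by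
  have h1 : ∀ k, historyBefore τ (servePolicy S p a J) s ω k
      = historyBefore τ (servePolicy S p a J) s' ω k := by
    intro k
    induction k with
    | zero => rfl
    | succ k ih => rw [historyBefore, historyBefore, ih, runInterval_servePolicy_seed s s']
  have h2 : ∀ k, deliveredIn τ (servePolicy S p a J) s ω k
      = deliveredIn τ (servePolicy S p a J) s' ω k := fun k => by
    rw [deliveredIn, deliveredIn, h1, runInterval_servePolicy_seed s s']
  simp only [pathThroughput, deliveryIndicator, h2]

end ServePolicy

/-! ### The bounds on the total timely throughput -/

theorem theorem1 (N M τ : ℕ) (hN : 1 ≤ N) (hτ : 1 ≤ τ)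
    (p : Fin N → Fin M → unitInterval)
    {S : Type*} [MeasurableSpace S] (ν : Measure S) [IsProbabilityMeasure ν] :
    (packingOptimum τ p : ℝ) - 2 * √((N : ℝ) * ((packingOptimum τ p : ℝ) + (N : ℝ) / 4))
        < maxThroughput τ p ν ∧
      maxThroughput τ p ν < (packingOptimum τ p : ℝ) + (N : ℝ) := by
  obtain ⟨b, hb, hmean⟩ := exists_uniform_bound (S := S) hN τ p
  -- Every almost sure lower bound on the throughput is at most `b`.
  have hR : ∀ (η : Policy N M S) (R : ℝ),
      (∀ᵐ z ∂(ν.prod (channelMeasure p)), R ≤ pathThroughput τ η z.1 z.2) → R ≤ b := by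
    intro η R h
    obtain ⟨s, hs⟩ := (Measure.ae_ae_of_ae_prod h).exists
    obtain ⟨ω, h1, h2⟩ := (hs.and (ae_pathThroughput_le p τ η s (hmean η s))).exists
    exact h1.trans h2
  have hb0 : 0 ≤ b := by
    obtain ⟨s⟩ : Nonempty S := nonempty_of_isProbabilityMeasure ν
    have h1 := hmean (servePolicy S p (fun _ => ⟨0, hN⟩) fun _ => ∅) s []
    exact le_trans (integral_nonneg fun ω => Nat.cast_nonneg _) h1
  have hT : ∀ η : Policy N M S, totalTimelyThroughput τ p ν η ≤ b := fun η =>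
    Real.sSup_le (hR η) hb0
  refine ⟨?_, (Real.iSup_le hT hb0).trans_lt hb⟩
  obtain ⟨a, J, hJ, hcap, hcard⟩ := exists_optimal_packing hN τ p
  set C : ℝ := (packingOptimum τ p : ℝ) with hC
  have hCJ : ∑ i, ((J i).card : ℝ) = C := by rw [hC, ← hcard]; push_cast; rfl
  have hN0 : (0 : ℝ) < N := by exact_mod_cast hN
  have hC0 : 0 ≤ C := Nat.cast_nonneg _
  set c := √((N : ℝ) * (C + (N : ℝ) / 4)) with hcdef
  have hc : 0 < c := Real.sqrt_pos.2 (by positivity)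
  have hNc : N * ∑ i, ((J i).card : ℝ) ≤ c ^ 2 := by
    rw [hcdef, Real.sq_sqrt (by positivity), hCJ]
    nlinarith
  set η := servePolicy S p a J
  have hmem : ∀ᵐ z ∂(ν.prod (channelMeasure p)), C - c ≤ pathThroughput τ η z.1 z.2 := by
    obtain ⟨s₀⟩ : Nonempty S := nonempty_of_isProbabilityMeasure ν
    have h1 := ae_le_pathThroughput p τ η s₀ fun h =>
      (hCJ ▸ le_integral_card_delivered_servePolicy hJ hcap hc hNc s₀ h :)
    filter_upwards [Measure.quasiMeasurePreserving_snd.ae h1] with z hz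
    exact hz.trans_eq (pathThroughput_servePolicy_seed τ s₀ z.1 z.2)
  calc C - 2 * c < C - c := by linarith
    _ ≤ totalTimelyThroughput τ p ν η := le_csSup ⟨b, hR η⟩ hmem
    _ ≤ maxThroughput τ p ν := le_ciSup ⟨b, by rintro _ ⟨η, rfl⟩; exact hT η⟩ η
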